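/- Let $m\ge 1$, let $K$ be a field of characteristic zero (for instance $K=\mathbb R$) and let $\lambda$ be an indeterminate. For $f=(f_0,\dots,f_m)\in K^{m+1}$ and $\alpha\in K$ put $$g=f_{m-1}\cdots f_1-\alpha,\qquad G=f_mf_{m-1}\cdots f_0-\alpha$$ (the empty product is $1$). Let $A$ and $B$ be the $(m+1)\times(m+1)$ matrices over $K(\lambda)$, with rows and columns numbered $0,\dots,m$, whose only nonzero entries are $$A_{s,s}=-f_s,\quad A_{s,s+1}=1,\qquad B_{s,s}=1,\quad B_{s,s+1}=-f_s\qquad (0\le s\le m-1)$$ and, in the last rows, $$A_{m,0}=\lambda,\quad A_{m,1}=-\frac{\lambda G}{gf_0},\quad A_{m,m}=\frac{G}{gf_0}-f_m,\qquad B_{m,0}=-\lambda f_m,\quad B_{m,1}=\lambda\frac{G}{g},\quad B_{m,m}=1-\frac{G}{g}$$ (if $m=1$, the two entries given for the position $(m,1)=(m,m)$ are added). Put $F[f,\alpha,\lambda]=B^{-1}A$ whenever this makes sense, that is, if $f_0\ne0$, $g\ne0$ and $\det B\ne0$. Below, $f^{(i)}$, $T_j(f^{(i)})$ etc. denote vectors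 with components $s=0,\dots,m-1$. In $F$, each such vector is completed by an arbitrary component with subscript $m$ for which $F$ makes sense; the statements below hold for every choice of these last components. "For generic values" means: outside the zero set of some nonzero polynomial, with coefficients in $K$, in the variables $f^{(i)}_s$, $0\le s\le m-1$, in question. Let parameters $\alpha^{(i)}\in K$ be assigned to the indices $i$, and for $0\le s\le m$ put $$P^{(i,j)}_s=\alpha^{(i)}f^{(j)}_{m-1}\cdots f^{(j)}_0-\alpha^{(j)}f^{(i)}_{m-1}\cdots f^{(i)}_0+\sum_{r=0}^{m-1}\gamma^{(i,j)}_{r,s}\,(f^{(i)}_r-f^{(j)}_r)\,f^{(i)}_{r-1}\cdots f^{(i)}_0\,f^{(j)}_{r-1}\cdots f^{(j)}_0,$$ where $\gamma^{(i,j)}_{r,s}=1$ if $s\le r$ and $\gamma^{(i,j)}_{r,s}=\alpha^{(i)}\alpha^{(j)}$ if $r<s$. (1) Let $\alpha^{(i)}\ne\alpha^{(j)}$ and, if $m=1$, let also $\alpha^{(i)}\ne1$ and $\alpha^{(j)}\ne1$. Then, for generic values of $f^{(i)},f^{(j)}$, the matrices $F[f^{(i)},\alpha^{(i)},\lambda]$,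 $F[f^{(j)},\alpha^{(j)},\lambda]$ make sense, and the equation $$F[T_i(f^{(j)}),\alpha^{(j)},\lambda]\,F[f^{(i)},\alpha^{(i)},\lambda]=F[T_j(f^{(i)}),\alpha^{(i)},\lambda]\,F[f^{(j)},\alpha^{(j)},\lambda],$$ considered as an identity with respect to $\lambda$, has one and only one solution $T_i(f^{(j)}),T_j(f^{(i)})\in K^m$ (among the vectors for which $F$ makes sense). The solution is $$T_j(f^{(i)}_s)=\frac{P^{(i,j)}_{s+1}}{f^{(j)}_sP^{(i,j)}_s},\qquad T_i(f^{(j)}_s)=\frac{P^{(j,i)}_{s+1}}{f^{(i)}_sP^{(j,i)}_s},\qquad s=0,\dots,m-1,$$ where the denominators do not vanish. (2) Let $\alpha^{(i)},\alpha^{(j)},\alpha^{(k)}$ be pairwise distinct. Then the mapping given by the above formula is 3D-consistent: for generic values of $f^{(i)},f^{(j)},f^{(k)}$, $$T_kT_j(f^{(i)}_s)=T_jT_k(f^{(i)}_s),\qquad s=0,\dots,m-1,$$ and no denominator in these expressions vanishes. Here $T_kT_j(f^{(i)})$ is obtained from the formula for $T_j(f^{(i)})$ by replacing $f^{(i)},f^{(j)}$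 with $T_k(f^{(i)}),T_k(f^{(j)})$. -/

import Mathlib

open Finset

namespace DSK

noncomputable section

variable {K : Type*} [Field K]

/-- The quantity `f_m f_{m-1} ⋯ f_0 - a`, for `f = (f_0, …, f_m)`. -/
def bigG {m : ℕ} (f : Fin (m + 1) → K) (a : K) : K :=
  (∏ s, f s) - a

/-- The quantity `f_{m-1} ⋯ f_1 - a`, for `f = (f_0, …, f_m)`
(the product is empty, hence equal to `1`, if `m = 1`). -/
def smallG {m : ℕ} (f : Fin (m + 1) → K) (a : K) : K :=
  (∏ s ∈ Finset.Ioo 0 (Fin.last m), f s) - a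

/-- The matrix `A`. Row `r < m` has the entry `-f_r` on the diagonal and `1` to the right of it; the
last row has `λ` in column `0`, `-λ G / (g f_0)` in column `1` and `G / (g f_0) - f_m` in
column `m` (for `m = 1` the last two are added up). The spectral parameter `λ` is the
indeterminate `RatFunc.X`. -/
def matA {m : ℕ} (f : Fin (m + 1) → K) (a : K) :
    Matrix (Fin (m + 1)) (Fin (m + 1)) (RatFunc K) :=
  fun r c =>
    if r.val < m then
      (if c.val = r.val then RatFunc.C (-f r) else if c.val = r.val + 1 then 1 else 0)
    else
      (if c.val = 0 then RatFunc.X else 0)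
        + (if c.val = 1 then
            -(RatFunc.X * RatFunc.C (bigG f a / (smallG f a * f 0))) else 0)
        + (if c.val = m then RatFunc.C (bigG f a / (smallG f a * f 0) - f (Fin.last m)) else 0)

/-- The matrix `B`. Row `r < m` has the entry `1` on the diagonal and `-f_r` to the right of it; the
last row has `-λ f_m` in column `0`, `λ G / g` in column `1` and `1 - G / g` in column `m`
(for `m = 1` the last two are added up). -/
def matB {m : ℕ} (f : Fin (m + 1) → K) (a : K) :
    Matrix (Fin (m + 1)) (Fin (m + 1)) (RatFunc K) :=
  fun r c =>
    if r.val < m then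
      (if c.val = r.val then 1 else if c.val = r.val + 1 then RatFunc.C (-f r) else 0)
    else
      (if c.val = 0 then -(RatFunc.X * RatFunc.C (f (Fin.last m))) else 0)
        + (if c.val = 1 then RatFunc.X * RatFunc.C (bigG f a / smallG f a) else 0)
        + (if c.val = m then RatFunc.C (1 - bigG f a / smallG f a) else 0)

/-- The Darboux matrix `F[f, a, λ] = B⁻¹ A`, over the field `K(λ)`. -/
def darboux {m : ℕ} (f : Fin (m + 1) → K) (a : K) :
    Matrix (Fin (m + 1)) (Fin (m + 1)) (RatFunc K) :=
  (matB f a)⁻¹ * matA f a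

/-- The expression `B⁻¹ A` makes sense: the denominators `f_0` and `g` in the entries do not vanish
and `B` is invertible over `K(λ)`. -/
def Regular {m : ℕ} (f : Fin (m + 1) → K) (a : K) : Prop :=
  f 0 ≠ 0 ∧ smallG f a ≠ 0 ∧ (matB f a).det ≠ 0

/-- The vector `(f_0, …, f_{m-1})` extended by a last component `f_m`. -/
def extend {m : ℕ} (f : Fin m → K) (fm : K) : Fin (m + 1) → K :=
  Fin.snoc (α := fun _ => K) f fm

/-- The coefficient `γ_{r,s}`. -/
def gam (a b : K) (r s : ℕ) : K := if s ≤ r then 1 else a * b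

/-- The polynomial `P_s`, `0 ≤ s ≤ m`, in `f = f^{(i)}`, `g = f^{(j)}`, with `a = α^{(i)}`,
`b = α^{(j)}`. -/
def P {m : ℕ} (a b : K) (f g : Fin m → K) (s : ℕ) : K :=
  a * ∏ t, g t - b * ∏ t, f t
    + ∑ r : Fin m, gam a b r.val s * (f r - g r) * (∏ t ∈ Finset.Iio r, f t)
        * ∏ t ∈ Finset.Iio r, g t

/-- The mapping `T_j`: the component `i` of `shift α j f` is the vector `T_j(f^{(i)})`, namely
`T_j(f^{(i)}_s) = P^{(i,j)}_{s+1} / (f^{(j)}_s P^{(i,j)}_s)`. Only `i ≠ j` is meant. -/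
def shift {ι : Type*} {m : ℕ} (α : ι → K) (j : ι) (f : ι → Fin m → K) : ι → Fin m → K :=
  fun i s => P (α i) (α j) (f i) (f j) (s.val + 1) / (f j s * P (α i) (α j) (f i) (f j) s.val)

/-- All the denominators in the formula for `T_j(f^{(i)})` are different from zero. -/
def ShiftDefined {ι : Type*} {m : ℕ} (α : ι → K) (j i : ι) (f : ι → Fin m → K) : Prop :=
  ∀ s : Fin m, f j s * P (α i) (α j) (f i) (f j) s.val ≠ 0

/-- The property `S` holds for generic values of the variables `f^{(i)}_s`: it holds outside
the zero set of some nonzero polynomial in these variables. -/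
def Generic {ι : Type*} {m : ℕ} (S : (ι → Fin m → K) → Prop) : Prop :=
  ∃ D : MvPolynomial (ι × Fin m) K, D ≠ 0 ∧
    ∀ f : ι → Fin m → K, MvPolynomial.eval (fun p => f p.1 p.2) D ≠ 0 → S f

/-- The refactorization equation `F[x, α^{(j)}] F[f^{(i)}, α^{(i)}] = F[y, α^{(i)}] F[f^{(j)}, α^{(j)}]`,
as an identity with respect to `λ`, is uniquely solved with respect to `x = T_i(f^{(j)})`,
`y = T_j(f^{(i)})`, and the solution is given by the mapping `shift`. The last components of the
four vectors (the values with subscript `m`) enter the entries of `A` and `B`; they are arbitrary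
as long as the matrices make sense. -/
def UniquelyRefactorizes {ι : Type*} {m : ℕ} (α : ι → K) (i j : ι) (f : ι → Fin m → K) : Prop :=
  (∃ c, Regular (extend (f i) c) (α i)) ∧ (∃ c, Regular (extend (f j) c) (α j)) ∧
  ShiftDefined α i j f ∧ ShiftDefined α j i f ∧
  (∃ c, Regular (extend (shift α i f j) c) (α j)) ∧
  (∃ c, Regular (extend (shift α j f i) c) (α i)) ∧
  ∀ (fm gm : K), Regular (extend (f i) fm) (α i) → Regular (extend (f j) gm) (α j) →
    ∀ (x y : Fin m → K) (xm ym : K), Regular (extend x xm) (α j) → Regular (extend y ym) (α i) →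
      (darboux (extend x xm) (α j) * darboux (extend (f i) fm) (α i)
          = darboux (extend y ym) (α i) * darboux (extend (f j) gm) (α j)
        ↔ x = shift α i f j ∧ y = shift α j f i)

/-- The property `T_k T_j(f^{(i)}_s) = T_j T_k(f^{(i)}_s)`, all terms being defined. In
`T_k T_j(f^{(i)})` the shift `T_k` acts on the arguments of `T_j(f^{(i)})`, so that this is the
mapping `T_j` evaluated at `T_k(f^{(i)})`, `T_k(f^{(j)})`. -/
def CubeConsistent {ι : Type*} {m : ℕ} (α : ι → K) (i j k : ι) (f : ι → Fin m → K) : Prop :=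
  ShiftDefined α k i f ∧ ShiftDefined α k j f ∧ ShiftDefined α j i (shift α k f) ∧
  ShiftDefined α j i f ∧ ShiftDefined α j k f ∧ ShiftDefined α k i (shift α j f) ∧
  ∀ s : Fin m, shift α j (shift α k f) i s = shift α k (shift α j f) i s

end

end DSK

/-! Write `S` for the cyclic shift with entry `λ` in the corner and `D_f` for the diagonal matrix of
a vector of length `m + 1`. One row operation, an invertible matrix `R` on the left, gives `B = R (1
- D S)` and `A = R (S - D)`, where `D` carries `f_0, …, f_{m-1}` and a last entry `α / (f_0 ⋯
f_{m-1})`. Hence `F = (1 - D S)⁻¹ (S - D)` does not depend on `f_m`, and it is the Darboux matrix of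
a cyclic chain whose components have product `α` (`Regular.darboux_eq`).

Existence. For cyclic chains, suitable scalars `κ_s` give `F[x] F[f] = 1 + D_κ (F[f] - F[g])`
(`cycDarboux_mul`). The right side is unchanged when `f, g` are exchanged and `κ` changes sign, so
both orders of factors agree. The choice `κ_s = (1 - αβ) f_0 ⋯ f_{s-1} g_0 ⋯ g_{s-1} / P_s`
corresponds to the stated formula (`cycDarboux_move`).

Uniqueness. With `λ = t^{m+1}` and conjugation by `diag(t^s)`, `S` becomes `t` times a permutation
matrix and `F` a power series matrix. The coefficients of `t^0` and `t^1` in the equation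
(`coeff_eq_of_cycDarboux_mul_eq`) yield a Riccati recursion for `κ_s`. It is linear in `1 / κ_s`,
and its periodicity determines the solution (`eq_kappa`, `eq_move_of_cycDarboux_mul_eq`).

3D consistency. `P` at shifted arguments equals, up to explicit factors, a polynomial `cubeP` that
only changes sign under exchange of the two shifts (`P_move`, `cubeP_swap`), so both double shifts
reduce to the same fraction.

Each genericity condition is the nonvanishing of a polynomial, checked at one simple point. -/

namespace DSK

variable {K : Type*} [Field K]

/-! ### Partial products and the polynomials `P_s` -/

/-- The product `f_0 ⋯ f_{n-1}` of the first `n` components. -/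
def pre {m : ℕ} (f : Fin m → K) (n : ℕ) : K := ∏ t with t.val < n, f t

/-- The sum of `(f_r - g_r) f_{r-1} ⋯ f_0 g_{r-1} ⋯ g_0` over `r < n`. -/
def theta {m : ℕ} (f g : Fin m → K) (n : ℕ) : K :=
  ∑ t with t.val < n, (f t - g t) * pre f t.val * pre g t.val

lemma filter_val_lt_succ {m : ℕ} (s : Fin m) :
    (univ.filter fun t : Fin m => t.val < s.val + 1)
      = insert s (univ.filter fun t : Fin m => t.val < s.val) := by
  ext t
  simp only [mem_filter, mem_univ, true_and, mem_insert, Fin.ext_iff]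
  omega

@[simp] lemma pre_zero {m : ℕ} (f : Fin m → K) : pre f 0 = 1 := by simp [pre]

@[simp] lemma theta_zero {m : ℕ} (f g : Fin m → K) : theta f g 0 = 0 := by simp [theta]

lemma pre_succ {m : ℕ} (f : Fin m → K) (s : Fin m) :
    pre f (s.val + 1) = pre f s.val * f s := by
  rw [pre, filter_val_lt_succ, prod_insert (by simp), mul_comm, pre]

lemma theta_succ {m : ℕ} (f g : Fin m → K) (s : Fin m) :
    theta f g (s.val + 1) = theta f g s.val + (f s - g s) * pre f s.val * pre g s.val := by
  rw [theta, filter_val_lt_succ, sum_insert (by simp), add_comm, theta]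

lemma pre_last {m : ℕ} (f : Fin m → K) : pre f m = ∏ t, f t := by
  simp [pre]

lemma prod_Iio_eq_pre {m : ℕ} (f : Fin m → K) (r : Fin m) :
    ∏ t ∈ Iio r, f t = pre f r.val := by
  rw [pre]; exact prod_congr (by ext t; rw [mem_Iio, mem_filter, Fin.lt_def]; simp) fun _ _ => rfl

lemma pre_ne_zero {m : ℕ} {f : Fin m → K} (hf : ∀ s, f s ≠ 0) (n : ℕ) : pre f n ≠ 0 :=
  prod_ne_zero_iff.2 fun t _ => hf t

/-- Isolates the dependence on `s` in one partial sum, so that consecutive `P_s` differ by a single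
term. -/
lemma P_eq {m : ℕ} (a b : K) (f g : Fin m → K) (s : ℕ) :
    P a b f g s = a * pre g m - b * pre f m + theta f g m + (a * b - 1) * theta f g s := by
  have h : ∀ r : Fin m, gam a b r.val s * (f r - g r) * (∏ t ∈ Iio r, f t) * ∏ t ∈ Iio r, g t
      = (f r - g r) * pre f r.val * pre g r.val
        + (a * b - 1) * (if r.val < s then (f r - g r) * pre f r.val * pre g r.val else 0) := by
    intro r
    rw [prod_Iio_eq_pre, prod_Iio_eq_pre, gam]
    by_cases hr : r.val < s
    · rw [if_neg (not_le.2 hr), if_pos hr]; ring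
    · rw [if_pos (not_lt.1 hr), if_neg hr]; ring
  rw [P, sum_congr rfl fun r _ => h r, sum_add_distrib, ← mul_sum, ← sum_filter, pre_last,
    pre_last, ← theta]
  simp [theta]
  ring

lemma P_succ {m : ℕ} (a b : K) (f g : Fin m → K) (s : Fin m) :
    P a b f g (s.val + 1)
      = P a b f g s.val + (a * b - 1) * ((f s - g s) * pre f s.val * pre g s.val) := by
  rw [P_eq, P_eq, theta_succ]; ring

lemma theta_swap {m : ℕ} (f g : Fin m → K) (n : ℕ) : theta g f n = -theta f g n := by
  rw [theta, theta, ← sum_neg_distrib]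
  exact sum_congr rfl fun t _ => by ring

lemma P_swap {m : ℕ} (a b : K) (f g : Fin m → K) (s : ℕ) : P b a g f s = -P a b f g s := by
  rw [P_eq, P_eq, theta_swap, theta_swap f g s]; ring

/-- Induction over the numbers `0, …, m`. -/
lemma induction_le {m : ℕ} {p : ℕ → Prop} (h0 : p 0) (hs : ∀ s : Fin m, p s.val → p (s.val + 1)) :
    ∀ n ≤ m, p n := by
  intro n
  induction n with
  | zero => exact fun _ => h0
  | succ n ih => exact fun hn => hs ⟨n, hn⟩ (ih (by omega))

/-! ### The mapping and its 3D consistency -/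

/-- The vector with the components `P_{s+1} / (g_s P_s)`. -/
def move {m : ℕ} (a b : K) (f g : Fin m → K) : Fin m → K :=
  fun s => P a b f g (s.val + 1) / (g s * P a b f g s.val)

/-- The product of the ratios `P_{s+1} / P_s` telescopes. -/
lemma pre_move {m : ℕ} {a b : K} {f g : Fin m → K} (hg : ∀ s, g s ≠ 0)
    (hP : ∀ n ≤ m, P a b f g n ≠ 0) :
    ∀ n ≤ m, pre (move a b f g) n = P a b f g n / (pre g n * P a b f g 0) := by
  have h0 := hP 0 (Nat.zero_le m)
  apply induction_le
  · simp [h0]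
  · intro s ih
    have h1 := hP s.val s.isLt.le
    have h2 := pre_ne_zero hg s.val
    have h3 := hg s
    rw [pre_succ, ih, move, pre_succ]
    field_simp

/-- The numerator of the expression `P` evaluated at shifted arguments. -/
def cubeP {m : ℕ} (a b c : K) (f g h : Fin m → K) (n : ℕ) : K :=
  (1 - a * b) * ((1 - c * a) * P b c g h n * pre f n - (1 - b * c) * P a c f h n * pre g n)
    + (1 - b * c) * (1 - c * a) * P a b f g n * pre h n

lemma cubeP_swap {m : ℕ} (a b c : K) (f g h : Fin m → K) (n : ℕ) :
    cubeP a c b f h g n = -cubeP a b c f g h n := by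
  rw [cubeP, cubeP, P_swap b c g h]; ring

/-- In each increment of the left side, expanding `P_{s+1}` about `P_s` cancels the product of the
two `P_s` and frees a factor `pre h s`. What remains (`key`) is the increment of the right side. -/
lemma theta_move {m : ℕ} {a b c : K} {f g h : Fin m → K} (hh : ∀ s, h s ≠ 0)
    (hP : ∀ n ≤ m, P a c f h n ≠ 0) (hQ : ∀ n ≤ m, P b c g h n ≠ 0) :
    ∀ n ≤ m, theta (move a c f h) (move b c g h) n * (P a c f h 0 * P b c g h 0) * pre h n
      = ((1 - c * a) * P b c g h 0 - (1 - b * c) * P a c f h 0) * pre h n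
        - ((1 - c * a) * P b c g h n * pre f n - (1 - b * c) * P a c f h n * pre g n)
        + (1 - b * c) * (1 - c * a) * theta f g n * pre h n := by
  have p0 := hP 0 (Nat.zero_le m)
  have q0 := hQ 0 (Nat.zero_le m)
  apply induction_le
  · simp
  · intro s ih
    have hs := s.isLt.le
    have hp := hP s.val hs
    have hq := hQ s.val hs
    have hH := pre_ne_zero hh s.val
    have h3 := hh s
    have key : (move a c f h s - move b c g h s) * pre (move a c f h) s.val
        * pre (move b c g h) s.val * (P a c f h 0 * P b c g h 0) * pre h s.val * h s
        = (a * c - 1) * (f s - h s) * pre f s.val * P b c g h s.val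
          - (b * c - 1) * (g s - h s) * pre g s.val * P a c f h s.val := by
      rw [pre_move hh hP _ hs, pre_move hh hQ _ hs, move, move]
      field_simp
      rw [P_succ, P_succ]
      ring
    rw [theta_succ, pre_succ, pre_succ, pre_succ, theta_succ, P_succ, P_succ]
    linear_combination h s * ih + key

/-- By `P_eq`, the value at `n` is a part independent of `n` (`total`) plus a multiple of `theta` at
`n`; `theta_move` evaluates both. -/
lemma P_move {m : ℕ} {a b c : K} {f g h : Fin m → K} (hh : ∀ s, h s ≠ 0)
    (hP : ∀ n ≤ m, P a c f h n ≠ 0) (hQ : ∀ n ≤ m, P b c g h n ≠ 0) (n : ℕ) (hn : n ≤ m) :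
    P a b (move a c f h) (move b c g h) n * (P a c f h 0 * P b c g h 0) * pre h n
      = cubeP a b c f g h n := by
  have p0 := hP 0 (Nat.zero_le m)
  have q0 := hQ 0 (Nat.zero_le m)
  have hHm := pre_ne_zero hh m
  have tm := theta_move hh hP hQ m le_rfl
  have tn := theta_move hh hP hQ n hn
  have e1 : pre (move a c f h) m * P a c f h 0 * pre h m = P a c f h m := by
    rw [pre_move hh hP m le_rfl]; field_simp
  have e2 : pre (move b c g h) m * P b c g h 0 * pre h m = P b c g h m := by
    rw [pre_move hh hQ m le_rfl]; field_simp
  have total : (a * pre (move b c g h) m - b * pre (move a c f h) m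
      + theta (move a c f h) (move b c g h) m) * (P a c f h 0 * P b c g h 0)
      = (1 - a * b) * ((1 - c * a) * P b c g h 0 - (1 - b * c) * P a c f h 0)
        + (1 - b * c) * (1 - c * a) * (a * pre g m - b * pre f m + theta f g m) := by
    apply mul_right_cancel₀ hHm
    -- Eliminating `P_m` in favour of `P_0` turns the case `n = m` of `theta_move` into an identity
    -- whose terms all carry the factor `pre h m`.
    have f1 : P a c f h m = a * c * P a c f h 0 - (a * c - 1) * (a * pre h m - c * pre f m) := by
      rw [P_eq, P_eq]; simp; ring
    have f2 : P b c g h m = b * c * P b c g h 0 - (b * c - 1) * (b * pre h m - c * pre g m) := by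
      rw [P_eq, P_eq]; simp; ring
    rw [f1, f2] at tm
    rw [f1] at e1
    rw [f2] at e2
    linear_combination tm + a * P a c f h 0 * e2 - b * P b c g h 0 * e1
  rw [P_eq a b (move a c f h), cubeP, P_eq a b f g]
  linear_combination pre h n * total + (a * b - 1) * tn

/-- After the factors `pre h` or `pre g` cancel, either side is `cubeP_{s+1} P_s / (cubeP_s
P_{s+1})` with `P` taken at `(b, c, g, h)`. -/
lemma move_move {m : ℕ} {a b c : K} {f g h : Fin m → K} (hg : ∀ s, g s ≠ 0) (hh : ∀ s, h s ≠ 0)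
    (hP : ∀ n ≤ m, P a c f h n ≠ 0) (hQ : ∀ n ≤ m, P b c g h n ≠ 0)
    (hR : ∀ n ≤ m, P a b f g n ≠ 0) :
    move a b (move a c f h) (move b c g h) = move a c (move a b f g) (move c b h g) := by
  have hQ' : ∀ n ≤ m, P c b h g n ≠ 0 := fun n hn => by
    rw [P_swap b c g h]; exact neg_ne_zero.2 (hQ n hn)
  have p0 := hP 0 (Nat.zero_le m)
  have q0 := hQ 0 (Nat.zero_le m)
  have q0' := hQ' 0 (Nat.zero_le m)
  have r0 := hR 0 (Nat.zero_le m)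
  have e1 : ∀ n ≤ m, P a b (move a c f h) (move b c g h) n
      = cubeP a b c f g h n / (P a c f h 0 * P b c g h 0 * pre h n) := by
    intro n hn
    have := pre_ne_zero hh n
    rw [← P_move hh hP hQ n hn]
    field_simp
  have e2 : ∀ n ≤ m, P a c (move a b f g) (move c b h g) n
      = cubeP a b c f g h n / (P a b f g 0 * P b c g h 0 * pre g n) := by
    intro n hn
    have := pre_ne_zero hg n
    have key := P_move hg hR hQ' n hn
    rw [cubeP_swap, P_swap b c g h] at key
    rw [eq_div_iff (by simp [*])]
    linear_combination -key
  funext s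
  have hq := hQ s.val s.isLt.le
  have hq1 := hQ (s.val + 1) s.isLt
  have h3 := hh s
  have h4 := hg s
  have h5 := pre_ne_zero hg s.val
  have h6 := pre_ne_zero hh s.val
  change P a b (move a c f h) (move b c g h) (s.val + 1)
      / (P b c g h (s.val + 1) / (h s * P b c g h s.val)
        * P a b (move a c f h) (move b c g h) s.val)
    = P a c (move a b f g) (move c b h g) (s.val + 1)
      / (P c b h g (s.val + 1) / (g s * P c b h g s.val)
        * P a c (move a b f g) (move c b h g) s.val)
  rw [e1 _ s.isLt, e1 _ s.isLt.le, e2 _ s.isLt, e2 _ s.isLt.le,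
    P_swap b c g h, P_swap b c g h, pre_succ, pre_succ]
  -- If `cubeP_s = 0`, both sides are `0` by the convention for division by zero.
  by_cases hW : cubeP a b c f g h s.val = 0
  · simp [hW]
  · field_simp

/-! ### Darboux matrices of cyclic chains -/

/-- The cyclic shift, with the entry `l` in place of `1` in the last row. -/
def cyc {R : Type*} [CommRing R] (m : ℕ) (l : R) : Matrix (Fin (m + 1)) (Fin (m + 1)) R :=
  fun r c => if c = r + 1 then (if r = Fin.last m then l else 1) else 0

lemma cyc_mul_diagonal {R : Type*} [CommRing R] {m : ℕ} (l : R) (k : Fin (m + 1) → R) :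
    cyc m l * Matrix.diagonal k = Matrix.diagonal (fun s => k (s + 1)) * cyc m l := by
  ext r c
  rw [Matrix.mul_diagonal, Matrix.diagonal_mul, cyc]
  by_cases h : c = r + 1
  · rw [h, mul_comm]
  · simp [h]

lemma map_cyc {R R' : Type*} [CommRing R] [CommRing R'] (φ : R →+* R') (m : ℕ) (l : R) :
    φ.mapMatrix (cyc m l) = cyc m (φ l) := by
  ext r c
  simp only [RingHom.mapMatrix_apply, Matrix.map_apply, cyc]
  split_ifs <;> simp

lemma map_diagonal {R R' : Type*} [CommRing R] [CommRing R'] (φ : R →+* R') {m : ℕ}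
    (d : Fin (m + 1) → R) :
    φ.mapMatrix (Matrix.diagonal d) = Matrix.diagonal fun s => φ (d s) := by
  rw [RingHom.mapMatrix_apply, Matrix.diagonal_map (map_zero φ)]

lemma det_one_sub_cyc_zero {R : Type*} [CommRing R] {m : ℕ} (d : Fin (m + 1) → R) :
    (1 - Matrix.diagonal d * cyc m 0).det = 1 := by
  have hc : ∀ r c : Fin (m + 1), c ≤ r → cyc m (0 : R) r c = 0 := by
    intro r c h
    rw [cyc]
    split_ifs with h1 h2
    · rfl
    · exfalso
      have := Fin.lt_last_iff_ne_last.2 h2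
      rw [h1] at h
      exact absurd (Fin.lt_add_one_iff.2 this) (not_lt.2 h)
    · rfl
  rw [Matrix.det_of_isUpperTriangular]
  · exact prod_eq_one fun s _ => by
      rw [Matrix.sub_apply, Matrix.diagonal_mul, hc s s le_rfl]; simp
  · intro r c h
    have h' : c < r := h
    rw [Matrix.sub_apply, Matrix.diagonal_mul, hc r c h'.le, Matrix.one_apply_ne h'.ne']
    simp

/-- The diagonal matrix of a constant vector over `K(λ)`. -/
noncomputable def diagC {m : ℕ} (f : Fin (m + 1) → K) :
    Matrix (Fin (m + 1)) (Fin (m + 1)) (RatFunc K) :=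
  Matrix.diagonal fun s => RatFunc.C (f s)

/-- The determinant is a polynomial in `λ`; at `λ = 0` the matrix is upper unitriangular, so the
value there is `1`. -/
lemma det_one_sub_ne_zero {m : ℕ} (f : Fin (m + 1) → K) :
    (1 - diagC f * cyc m RatFunc.X).det ≠ 0 := by
  have h : (algebraMap (Polynomial K) (RatFunc K)).mapMatrix
      (1 - Matrix.diagonal (fun s => Polynomial.C (f s)) * cyc m Polynomial.X)
      = 1 - diagC f * cyc m RatFunc.X := by
    rw [map_sub, map_mul, map_one, map_cyc, map_diagonal, RatFunc.algebraMap_X]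
    simp only [RatFunc.algebraMap_C]
    rfl
  rw [← h, ← RingHom.map_det]
  refine (map_ne_zero_iff _ (RatFunc.algebraMap_injective K)).2 fun h0 => ?_
  have h1 : (Polynomial.evalRingHom (0 : K)) (1 - Matrix.diagonal (fun s => Polynomial.C (f s))
      * cyc m Polynomial.X).det = 1 := by
    rw [RingHom.map_det, map_sub, map_mul, map_one, map_cyc, map_diagonal]
    simp only [Polynomial.coe_evalRingHom, Polynomial.eval_X]
    exact det_one_sub_cyc_zero _
  rw [h0, map_zero] at h1
  exact zero_ne_one h1

/-- The Darboux matrix of a cyclic chain of length `m + 1`. -/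
noncomputable def cycDarboux {m : ℕ} (f : Fin (m + 1) → K) :
    Matrix (Fin (m + 1)) (Fin (m + 1)) (RatFunc K) :=
  (1 - diagC f * cyc m RatFunc.X)⁻¹ * (cyc m RatFunc.X - diagC f)

lemma mul_cycDarboux {m : ℕ} (f : Fin (m + 1) → K) :
    (1 - diagC f * cyc m RatFunc.X) * cycDarboux f = cyc m RatFunc.X - diagC f := by
  rw [cycDarboux, Matrix.mul_nonsing_inv_cancel_left _ _ (det_one_sub_ne_zero f).isUnit]

lemma diagC_mul {m : ℕ} (f g : Fin (m + 1) → K) :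
    diagC f * diagC g = diagC fun s => f s * g s := by
  simp [diagC, Matrix.diagonal_mul_diagonal]

/-- Multiply by `1 - D_x S`. Moving `D_κ` through `S` shifts its index, and `h1` gives `D_x S D_κ =
D_κ D_g S`. Substituting `F = S - D_f + D_f S F`, and likewise for `g`, leaves `D_κ (D_f - D_g)(S F
- 1)`, which `h2` turns into `(1 - D_x D_f)(S F - 1)`. -/
lemma cycDarboux_mul {m : ℕ} {f g x κ : Fin (m + 1) → K}
    (h1 : ∀ s, x s * κ (s + 1) = κ s * g s) (h2 : ∀ s, 1 - x s * f s = κ s * (f s - g s)) :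
    cycDarboux x * cycDarboux f = 1 + diagC κ * (cycDarboux f - cycDarboux g) := by
  set S : Matrix (Fin (m + 1)) (Fin (m + 1)) (RatFunc K) := cyc m RatFunc.X with hS
  set F := cycDarboux f
  set G := cycDarboux g
  have hF : F = S - diagC f + diagC f * S * F := by
    rw [← mul_cycDarboux f]; noncomm_ring
  have hG : G = S - diagC g + diagC g * S * G := by
    rw [← mul_cycDarboux g]; noncomm_ring
  have hk : S * diagC κ = (diagC fun s => κ (s + 1)) * S := cyc_mul_diagonal _ _
  have e1 : diagC x * (diagC fun s => κ (s + 1)) = diagC κ * diagC g := by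
    rw [diagC_mul, diagC_mul]; simp only [h1]
  have e2 : (1 : Matrix (Fin (m + 1)) (Fin (m + 1)) (RatFunc K)) - diagC x * diagC f
      = diagC κ * diagC f - diagC κ * diagC g := by
    rw [diagC_mul, diagC_mul, diagC_mul, ← Matrix.diagonal_one, diagC, diagC, diagC,
      Matrix.diagonal_sub, Matrix.diagonal_sub]
    congr 1
    funext s
    rw [← map_sub, ← mul_sub, ← h2 s, map_sub, map_one]
  have key : (1 - diagC x * S) * (1 + diagC κ * (F - G)) = (S - diagC x) * F := by
    have a1 : diagC κ * F = diagC κ * (S - diagC f + diagC f * S * F) := by rw [← hF]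
    have a2 : diagC κ * G = diagC κ * (S - diagC g + diagC g * S * G) := by rw [← hG]
    have a3 : diagC x * F = diagC x * (S - diagC f + diagC f * S * F) := by rw [← hF]
    have a4 : diagC x * S * diagC κ * (F - G) = diagC κ * diagC g * S * (F - G) := by
      rw [← e1, mul_assoc (diagC x) S, hk]; noncomm_ring
    have a5 : diagC x * diagC f * (S * F - 1)
        = (1 - (diagC κ * diagC f - diagC κ * diagC g)) * (S * F - 1) := by
      rw [← e2]; noncomm_ring
    linear_combination (norm := noncomm_ring) a1 - a2 + a3 - a4 + a5
  have hu := (det_one_sub_ne_zero x).isUnit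
  rw [cycDarboux, mul_assoc, ← key, Matrix.nonsing_inv_mul_cancel_left _ _ hu]

lemma cycDarboux_mul_eq {m : ℕ} {f g x y κ : Fin (m + 1) → K}
    (h1 : ∀ s, x s * κ (s + 1) = κ s * g s) (h2 : ∀ s, 1 - x s * f s = κ s * (f s - g s))
    (h3 : ∀ s, y s * κ (s + 1) = κ s * f s) (h4 : ∀ s, 1 - y s * g s = κ s * (f s - g s)) :
    cycDarboux x * cycDarboux f = cycDarboux y * cycDarboux g := by
  have h5 := cycDarboux_mul (f := g) (g := f) (x := y) (κ := fun s => -κ s)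
    (fun s => by linear_combination -h3 s) (fun s => by linear_combination h4 s)
  have h6 : diagC (fun s => -κ s) = -diagC κ := by
    simp only [diagC, map_neg]
    exact (Matrix.diagonal_neg _).symm
  rw [cycDarboux_mul h1 h2, h5, h6]
  noncomm_ring

/-! ### Expansion in `t`, where `λ = t^{m+1}` -/

/-- The embedding `K(λ) → K((t))` with `λ = t^{m+1}`. -/
noncomputable def rootEmb (K : Type*) [Field K] (m : ℕ) : RatFunc K →+* LaurentSeries K :=
  RatFunc.liftRingHom
    (((HahnSeries.ofPowerSeries ℤ K).comp Polynomial.coeToPowerSeries.ringHom).comp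
      (Polynomial.expand K (m + 1)).toRingHom)
    (nonZeroDivisors_le_comap_nonZeroDivisors_of_injective _
      ((HahnSeries.ofPowerSeries_injective.comp (Polynomial.coe_injective K)).comp
        (Polynomial.expand_injective (Nat.succ_pos m))))

lemma rootEmb_X (m : ℕ) : rootEmb K m RatFunc.X
    = HahnSeries.ofPowerSeries ℤ K (PowerSeries.X ^ (m + 1)) := by
  rw [rootEmb, ← RatFunc.algebraMap_X, RatFunc.liftRingHom_algebraMap]
  simp

lemma rootEmb_C (m : ℕ) (a : K) : rootEmb K m (RatFunc.C a)
    = HahnSeries.ofPowerSeries ℤ K (PowerSeries.C a) := by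
  rw [rootEmb, ← RatFunc.algebraMap_C, RatFunc.liftRingHom_algebraMap]
  simp

/-- The diagonal matrix of a constant vector over `K[[t]]`. -/
noncomputable def diagPS {m : ℕ} (f : Fin (m + 1) → K) :
    Matrix (Fin (m + 1)) (Fin (m + 1)) (PowerSeries K) :=
  Matrix.diagonal fun s => PowerSeries.C (f s)

/-- The matrix `1 - t D C` over `K[[t]]`, where `C` is the cyclic permutation matrix. -/
noncomputable def denPS {m : ℕ} (f : Fin (m + 1) → K) :
    Matrix (Fin (m + 1)) (Fin (m + 1)) (PowerSeries K) :=
  1 - diagPS f * ((PowerSeries.X : PowerSeries K) • cyc m 1)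

/-- The Darboux matrix of a cyclic chain after the gauge transformation to `K[[t]]`. -/
noncomputable def gaugedDarboux {m : ℕ} (f : Fin (m + 1) → K) :
    Matrix (Fin (m + 1)) (Fin (m + 1)) (PowerSeries K) :=
  (denPS f)⁻¹ * ((PowerSeries.X : PowerSeries K) • cyc m 1 - diagPS f)

lemma map_diagPS {m : ℕ} (f : Fin (m + 1) → K) :
    PowerSeries.constantCoeff.mapMatrix (diagPS f) = Matrix.diagonal f := by
  rw [diagPS, map_diagonal]
  simp

lemma map_X_smul {m : ℕ} (M : Matrix (Fin (m + 1)) (Fin (m + 1)) (PowerSeries K)) :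
    PowerSeries.constantCoeff.mapMatrix ((PowerSeries.X : PowerSeries K) • M) = 0 := by
  ext r c; simp

lemma isUnit_det_denPS {m : ℕ} (f : Fin (m + 1) → K) : IsUnit (denPS f).det := by
  rw [PowerSeries.isUnit_iff_constantCoeff, RingHom.map_det, denPS, map_sub, map_mul, map_one,
    map_X_smul, mul_zero, sub_zero, Matrix.det_one]
  exact isUnit_one

lemma denPS_mul {m : ℕ} (f : Fin (m + 1) → K) :
    denPS f * gaugedDarboux f = (PowerSeries.X : PowerSeries K) • cyc m 1 - diagPS f := by
  rw [gaugedDarboux, Matrix.mul_nonsing_inv_cancel_left _ _ (isUnit_det_denPS f)]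

/-- The gauge matrix with the entries `t^s`. -/
noncomputable def gauge (K : Type*) [Field K] (m : ℕ) :
    Matrix (Fin (m + 1)) (Fin (m + 1)) (LaurentSeries K) :=
  Matrix.diagonal fun s => HahnSeries.ofPowerSeries ℤ K (PowerSeries.X ^ s.val)

/-- The exponent `m + 1` is what makes the corner entry agree with the others: `λ t^0 = t^m · t`. -/
lemma cyc_mul_gauge (m : ℕ) :
    (rootEmb K m).mapMatrix (cyc m RatFunc.X) * gauge K m
      = gauge K m * (HahnSeries.ofPowerSeries ℤ K).mapMatrix
          ((PowerSeries.X : PowerSeries K) • cyc m 1) := by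
  rw [map_cyc, gauge]
  ext1 r c
  rw [Matrix.mul_diagonal, Matrix.diagonal_mul, RingHom.mapMatrix_apply, Matrix.map_apply,
    Matrix.smul_apply, cyc, cyc, smul_eq_mul, rootEmb_X]
  by_cases h : c = r + 1
  · subst h
    rw [if_pos rfl, if_pos rfl]
    induction r using Fin.lastCases with
    | last =>
      rw [if_pos rfl, if_pos rfl, Fin.last_add_one, ← map_mul, ← map_mul]
      congr 1
      simp [pow_succ]
    | cast t =>
      have ht : t.castSucc ≠ Fin.last m := (Fin.castSucc_lt_last t).ne
      rw [if_neg ht, if_neg ht, Fin.coeSucc_eq_succ, ← map_mul, one_mul]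
      congr 1
      simp [pow_succ]
  · simp [h]

lemma diagC_mul_gauge {m : ℕ} (f : Fin (m + 1) → K) :
    (rootEmb K m).mapMatrix (diagC f) * gauge K m
      = gauge K m * (HahnSeries.ofPowerSeries ℤ K).mapMatrix (diagPS f) := by
  rw [diagC, diagPS, map_diagonal, map_diagonal, gauge, Matrix.diagonal_mul_diagonal,
    Matrix.diagonal_mul_diagonal]
  congr 1
  funext s
  rw [rootEmb_C, mul_comm]

/-- The gauge intertwines numerators and denominators separately; the invertible factor `1 - D S` is
then cancelled. -/
lemma cycDarboux_mul_gauge {m : ℕ} (f : Fin (m + 1) → K) :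
    (rootEmb K m).mapMatrix (cycDarboux f) * gauge K m
      = gauge K m * (HahnSeries.ofPowerSeries ℤ K).mapMatrix (gaugedDarboux f) := by
  have h1 := congrArg (rootEmb K m).mapMatrix (mul_cycDarboux f)
  have h2 := congrArg (HahnSeries.ofPowerSeries ℤ K).mapMatrix (denPS_mul f)
  rw [map_mul, map_sub, map_sub, map_one, map_mul] at h1
  rw [map_mul, denPS, map_sub, map_sub, map_one, map_mul] at h2
  have hs := cyc_mul_gauge (K := K) m
  have hd := diagC_mul_gauge f
  have hu : IsUnit ((rootEmb K m).mapMatrix (1 - diagC f * cyc m RatFunc.X)).det := by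
    rw [← RingHom.map_det]
    exact (det_one_sub_ne_zero f).isUnit.map _
  rw [map_sub, map_one, map_mul] at hu
  set S := (rootEmb K m).mapMatrix (cyc m RatFunc.X)
  set D := (rootEmb K m).mapMatrix (diagC f)
  set F := (rootEmb K m).mapMatrix (cycDarboux f)
  set T := gauge K m
  set S' := (HahnSeries.ofPowerSeries ℤ K).mapMatrix ((PowerSeries.X : PowerSeries K) • cyc m 1)
  set D' := (HahnSeries.ofPowerSeries ℤ K).mapMatrix (diagPS f)
  set F' := (HahnSeries.ofPowerSeries ℤ K).mapMatrix (gaugedDarboux f)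
  have key : (1 - D * S) * (F * T) = (1 - D * S) * (T * F') := by
    have e1 : (1 - D * S) * (F * T) = T * (S' - D') := by
      rw [← mul_assoc, h1, sub_mul, hs, hd, mul_sub]
    have e2 : (1 - D * S) * (T * F') = T * ((1 - D' * S') * F') := by
      have : D * S * T = T * (D' * S') := by
        rw [mul_assoc, hs, ← mul_assoc, hd, mul_assoc]
      rw [← mul_assoc, sub_mul, this, one_mul]
      noncomm_ring
    rw [e1, e2, h2]
  have := congrArg (fun M => (1 - D * S)⁻¹ * M) key
  simpa only [Matrix.nonsing_inv_mul_cancel_left _ _ hu] using this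

lemma gaugedDarboux_mul_eq {m : ℕ} {f g x y : Fin (m + 1) → K}
    (h : cycDarboux x * cycDarboux f = cycDarboux y * cycDarboux g) :
    gaugedDarboux x * gaugedDarboux f = gaugedDarboux y * gaugedDarboux g := by
  have hm : ∀ u v : Fin (m + 1) → K,
      (rootEmb K m).mapMatrix (cycDarboux u * cycDarboux v) * gauge K m
        = gauge K m * (HahnSeries.ofPowerSeries ℤ K).mapMatrix
            (gaugedDarboux u * gaugedDarboux v) := by
    intro u v
    rw [map_mul, mul_assoc, cycDarboux_mul_gauge, ← mul_assoc, cycDarboux_mul_gauge, mul_assoc,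
      map_mul]
  have h1 := hm x f
  rw [h, hm y g] at h1
  ext1 r c
  have h2 := congrFun (congrFun h1 r) c
  rw [gauge, Matrix.diagonal_mul, Matrix.diagonal_mul] at h2
  have h3 : HahnSeries.ofPowerSeries ℤ K (PowerSeries.X ^ r.val) ≠ 0 := by
    rw [map_ne_zero_iff _ HahnSeries.ofPowerSeries_injective]
    exact pow_ne_zero _ PowerSeries.X_ne_zero
  exact (HahnSeries.ofPowerSeries_injective (mul_left_cancel₀ h3 h2)).symm

/-- The coefficient of the gauged Darboux matrix at `t`, up to higher order terms. -/
noncomputable def gaugedTail {m : ℕ} (f : Fin (m + 1) → K) :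
    Matrix (Fin (m + 1)) (Fin (m + 1)) (PowerSeries K) :=
  cyc m 1 + diagPS f * cyc m 1 * gaugedDarboux f

lemma gaugedDarboux_eq {m : ℕ} (f : Fin (m + 1) → K) :
    gaugedDarboux f = (PowerSeries.X : PowerSeries K) • gaugedTail f - diagPS f := by
  have h := denPS_mul f
  rw [denPS, sub_mul, one_mul, sub_eq_iff_eq_add] at h
  rw [h, gaugedTail, smul_add]
  simp only [Matrix.mul_smul, Matrix.smul_mul]
  abel

lemma map_gaugedTail {m : ℕ} (f : Fin (m + 1) → K) :
    PowerSeries.constantCoeff.mapMatrix (gaugedTail f)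
      = cyc m 1 - Matrix.diagonal f * cyc m 1 * Matrix.diagonal f := by
  rw [gaugedTail, gaugedDarboux_eq, map_add, map_mul, map_mul, map_sub, map_X_smul, map_cyc,
    map_diagPS, map_one, zero_sub, mul_neg, sub_eq_add_neg]

/-- The gauged matrix is `-D + t (C - D C D) + O(t^2)` with `C` the cyclic permutation. The first
equation is the coefficient of `t^0` in the product, the second is the entry `(s, s + 1)` of the
coefficient of `t^1`. -/
lemma coeff_eq_of_cycDarboux_mul_eq {m : ℕ} {f g x y : Fin (m + 1) → K}
    (h : cycDarboux x * cycDarboux f = cycDarboux y * cycDarboux g) (s : Fin (m + 1)) :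
    x s * f s = y s * g s ∧
      x s * (1 - f s * f (s + 1)) + (1 - x s * x (s + 1)) * f (s + 1)
        = y s * (1 - g s * g (s + 1)) + (1 - y s * y (s + 1)) * g (s + 1) := by
  have h1 := gaugedDarboux_mul_eq h
  have hexp : ∀ u v : Fin (m + 1) → K, gaugedDarboux u * gaugedDarboux v
      = diagPS u * diagPS v + (PowerSeries.X : PowerSeries K) •
        ((PowerSeries.X : PowerSeries K) • (gaugedTail u * gaugedTail v)
          - diagPS u * gaugedTail v - gaugedTail u * diagPS v) := by
    intro u v
    rw [gaugedDarboux_eq, gaugedDarboux_eq]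
    simp only [sub_mul, mul_sub, Matrix.mul_smul, Matrix.smul_mul, smul_sub]
    abel
  rw [hexp, hexp] at h1
  have hdiag : ∀ t, x t * f t = y t * g t := by
    intro t
    have h2 := congrArg PowerSeries.constantCoeff.mapMatrix h1
    rw [map_add, map_add, map_X_smul, map_X_smul, map_mul, map_mul, map_diagPS, map_diagPS,
      map_diagPS, map_diagPS, add_zero, add_zero, Matrix.diagonal_mul_diagonal,
      Matrix.diagonal_mul_diagonal] at h2
    exact congrFun (Matrix.diagonal_injective h2) t
  refine ⟨hdiag s, ?_⟩
  have h0 : diagPS x * diagPS f = diagPS y * diagPS g := by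
    rw [diagPS, diagPS, diagPS, diagPS, Matrix.diagonal_mul_diagonal,
      Matrix.diagonal_mul_diagonal]
    congr 1
    funext t
    rw [← map_mul, ← map_mul, hdiag]
  rw [h0] at h1
  have h2 := smul_right_injective _ (PowerSeries.X_ne_zero (R := K)) (add_left_cancel h1)
  have h3 := congrArg PowerSeries.constantCoeff.mapMatrix h2
  simp only [map_sub, map_mul, map_X_smul, map_diagPS, map_gaugedTail] at h3
  have h4 := congrFun (congrFun h3 s) (s + 1)
  simp only [Matrix.sub_apply, Matrix.zero_apply, Matrix.mul_diagonal, Matrix.diagonal_mul,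
    cyc, if_true, ite_self] at h4
  linear_combination -h4

/-! ### Reduction of `A` and `B` to a cyclic chain -/

@[simp] lemma extend_castSucc {L : Type*} {m : ℕ} (f : Fin m → L) (c : L) (s : Fin m) :
    extend f c s.castSucc = f s := by
  rw [extend]; exact Fin.snoc_castSucc (α := fun _ => L) _ _ _

@[simp] lemma extend_last {L : Type*} {m : ℕ} (f : Fin m → L) (c : L) :
    extend f c (Fin.last m) = c := by
  rw [extend]; exact Fin.snoc_last (α := fun _ => L) _ _

@[simp] lemma extend_zero {L : Type*} {k : ℕ} (f : Fin (k + 1) → L) (c : L) : extend f c 0 = f 0 :=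
  extend_castSucc f c 0

/-- The product `f_1 ⋯ f_{m-1}`, where `m = k + 1`. -/
def tail {k : ℕ} (f : Fin (k + 1) → K) : K := ∏ i : Fin k, f i.succ

lemma pre_eq_tail {k : ℕ} (f : Fin (k + 1) → K) : pre f (k + 1) = f 0 * tail f := by
  rw [pre_last, Fin.prod_univ_succ, tail]

lemma bigG_extend {k : ℕ} (f : Fin (k + 1) → K) (c a : K) :
    bigG (extend f c) a = f 0 * tail f * c - a := by
  rw [bigG, Fin.prod_univ_castSucc]
  simp only [extend_castSucc, extend_last]
  rw [← pre_eq_tail, pre_last]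

lemma smallG_extend {k : ℕ} (f : Fin (k + 1) → K) (c a : K) :
    smallG (extend f c) a = tail f - a := by
  have h : Ioo 0 (Fin.last (k + 1)) = univ.map ((Fin.succEmb k).trans Fin.castSuccEmb) := by
    ext s
    simp only [mem_Ioo, mem_map, mem_univ, true_and, Function.Embedding.trans_apply,
      Fin.coe_succEmb, Fin.coe_castSuccEmb]
    constructor
    · rintro ⟨h0, h1⟩
      obtain ⟨t, rfl⟩ := Fin.exists_castSucc_eq.2 h1.ne
      have ht : t ≠ 0 := by
        rintro rfl
        exact h0.ne rfl
      obtain ⟨i, rfl⟩ := Fin.exists_succ_eq_of_ne_zero ht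
      exact ⟨i, rfl⟩
    · rintro ⟨i, rfl⟩
      exact ⟨Fin.castSucc_pos (Fin.succ_pos i), Fin.castSucc_lt_last _⟩
  rw [smallG, h, prod_map]
  simp only [Function.Embedding.trans_apply, Fin.coe_succEmb, Fin.coe_castSuccEmb,
    extend_castSucc, tail]

/-- The row transformation that takes the matrices of a cyclic chain to `A` and `B`. -/
noncomputable def rowOp (k : ℕ) (u w : K) :
    Matrix (Fin (k + 2)) (Fin (k + 2)) (RatFunc K) :=
  diagC (Function.update (fun _ => 1) (Fin.last (k + 1)) u)
    - Matrix.single (Fin.last (k + 1)) 0 (RatFunc.X * RatFunc.C w)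

lemma rowOp_mul_castSucc {k : ℕ} (u w : K) (M : Matrix (Fin (k + 2)) (Fin (k + 2)) (RatFunc K))
    (r : Fin (k + 1)) (c : Fin (k + 2)) : (rowOp k u w * M) r.castSucc c = M r.castSucc c := by
  have hr := (Fin.castSucc_lt_last r).ne
  rw [rowOp, sub_mul, Matrix.sub_apply, Matrix.single_mul_apply_of_ne _ _ _ _ _ hr, diagC,
    Matrix.diagonal_mul, Function.update_of_ne hr]
  simp

lemma rowOp_mul_last {k : ℕ} (u w : K) (M : Matrix (Fin (k + 2)) (Fin (k + 2)) (RatFunc K))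
    (c : Fin (k + 2)) : (rowOp k u w * M) (Fin.last (k + 1)) c
      = RatFunc.C u * M (Fin.last (k + 1)) c - RatFunc.X * RatFunc.C w * M 0 c := by
  rw [rowOp, sub_mul, Matrix.sub_apply, Matrix.single_mul_apply_same, diagC,
    Matrix.diagonal_mul, Function.update_self]

lemma det_rowOp {k : ℕ} (u w : K) : (rowOp k u w).det = RatFunc.C u := by
  rw [Matrix.det_of_isLowerTriangular]
  · rw [Fin.prod_univ_castSucc, prod_eq_one]
    · simp [rowOp, diagC]
    · intro i _
      have hi := (Fin.castSucc_lt_last i).ne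
      simp [rowOp, diagC, hi, hi.symm]
  · intro i j hij
    have h : i < j := hij
    rw [rowOp, diagC, Matrix.sub_apply, Matrix.diagonal_apply_ne _ h.ne, Matrix.single_apply]
    rw [if_neg, sub_zero]
    rintro ⟨rfl, rfl⟩
    exact absurd h (Fin.not_lt_zero _)

section Closed

variable {k : ℕ} (f : Fin (k + 1) → K) (c a d : K)

/-- The quantity `G / (g f_0)`. -/
noncomputable def ratio : K := bigG (extend f c) a / (smallG (extend f c) a * f 0)

lemma ratio_mul (h0 : f 0 ≠ 0) :
    ratio f c a * f 0 = bigG (extend f c) a / smallG (extend f c) a := by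
  rw [ratio, ← div_div, div_mul_cancel₀ _ h0]

/-- With `ρ = ratio f c a`, the last row is scaled by `1 - ρ f_0` and `λ ρ` times row `0` is
subtracted. Column `0` of the last row then forces the relation `hd` for `d`. -/
lemma matB_eq_rowOp_mul (h0 : f 0 ≠ 0)
    (hd : (1 - ratio f c a * f 0) * d = c - ratio f c a) :
    matB (extend f c) a = rowOp k (1 - ratio f c a * f 0) (ratio f c a)
      * (1 - diagC (extend f d) * cyc (k + 1) RatFunc.X) := by
  ext1 r s
  induction r using Fin.lastCases with
  | cast t =>
    rw [rowOp_mul_castSucc, Matrix.sub_apply, diagC, Matrix.diagonal_mul, cyc, matB,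
      Matrix.one_apply, if_pos (by simp; omega), if_neg (Fin.castSucc_lt_last t).ne,
      Fin.coeSucc_eq_succ]
    by_cases h1 : s = t.castSucc
    · subst h1
      have : t.castSucc ≠ t.succ := Fin.castSucc_lt_succ.ne
      simp [this]
    · have h1' : s.val ≠ t.castSucc.val := fun h => h1 (Fin.ext h)
      rw [if_neg h1', if_neg (Ne.symm h1)]
      by_cases h2 : s = t.succ
      · subst h2; simp
      · have h2' : s.val ≠ t.castSucc.val + 1 := fun h => h2 (Fin.ext h)
        rw [if_neg h2', if_neg h2]; simp
  | last =>
    have e0 : (s.val = 0) = (s = 0) := by rw [Fin.ext_iff]; simp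
    have e1 : (s.val = 1) = (s = 1) := by rw [Fin.ext_iff]; simp
    have e2 : (s.val = k + 1) = (s = Fin.last (k + 1)) := by rw [Fin.ext_iff]; simp
    have h0l : (0 : Fin (k + 2)) ≠ Fin.last (k + 1) := (Fin.last_pos).ne
    have hd' := congrArg RatFunc.C hd
    rw [map_mul, map_sub] at hd'
    rw [rowOp_mul_last, matB, ← ratio_mul f c a h0]
    simp only [Matrix.sub_apply, diagC, Matrix.diagonal_mul, cyc, Matrix.one_apply, h0l,
      Fin.last_add_one, zero_add, Fin.val_last, lt_irrefl, if_false, if_true, e0, e1, e2,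
      extend_last, extend_zero, eq_comm (a := (0 : Fin (k + 2))),
      eq_comm (a := Fin.last (k + 1))]
    simp only [map_sub, map_mul, map_one] at hd' ⊢
    split_ifs <;> first | ring1 | linear_combination RatFunc.X * hd'

lemma matA_eq_rowOp_mul
    (hd : (1 - ratio f c a * f 0) * d = c - ratio f c a) :
    matA (extend f c) a = rowOp k (1 - ratio f c a * f 0) (ratio f c a)
      * (cyc (k + 1) RatFunc.X - diagC (extend f d)) := by
  ext1 r s
  induction r using Fin.lastCases with
  | cast t =>
    rw [rowOp_mul_castSucc, Matrix.sub_apply, diagC, Matrix.diagonal_apply, cyc, matA,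
      if_pos (by simp; omega), if_neg (Fin.castSucc_lt_last t).ne,
      Fin.coeSucc_eq_succ]
    by_cases h1 : s = t.castSucc
    · subst h1
      have : t.castSucc ≠ t.succ := Fin.castSucc_lt_succ.ne
      simp [this]
    · have h1' : s.val ≠ t.castSucc.val := fun h => h1 (Fin.ext h)
      rw [if_neg h1', if_neg (Ne.symm h1)]
      by_cases h2 : s = t.succ
      · subst h2; simp
      · have h2' : s.val ≠ t.castSucc.val + 1 := fun h => h2 (Fin.ext h)
        rw [if_neg h2', if_neg h2]; simp
  | last =>
    have e0 : (s.val = 0) = (s = 0) := by rw [Fin.ext_iff]; simp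
    have e1 : (s.val = 1) = (s = 1) := by rw [Fin.ext_iff]; simp
    have e2 : (s.val = k + 1) = (s = Fin.last (k + 1)) := by rw [Fin.ext_iff]; simp
    have h0l : (0 : Fin (k + 2)) ≠ Fin.last (k + 1) := (Fin.last_pos).ne
    have hd' := congrArg RatFunc.C hd
    rw [map_mul, map_sub] at hd'
    rw [rowOp_mul_last, matA, extend_last, extend_zero, ← ratio]
    simp only [Matrix.sub_apply, diagC, Matrix.diagonal_apply, cyc, h0l,
      Fin.last_add_one, zero_add, Fin.val_last, lt_irrefl, if_false, if_true, e0, e1, e2,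
      extend_last, extend_zero, eq_comm (a := (0 : Fin (k + 2))),
      eq_comm (a := Fin.last (k + 1))]
    simp only [map_sub, map_mul, map_one] at hd' ⊢
    split_ifs <;> first | ring1 | linear_combination hd'

variable {f c a}

/-- If the product vanishes, then `G / g = 1` and the last row of `B` lives in columns `0` and `1`.
The nonzero vector `v_r = f_r ⋯ f_{m-1}` is killed by the upper rows, and `v_0 = v_1 = 0`, so it
lies in the kernel. -/
lemma tail_ne_zero_of_det_ne_zero (h0 : f 0 ≠ 0) (hg : smallG (extend f c) a ≠ 0)
    (hB : (matB (extend f c) a).det ≠ 0) : tail f ≠ 0 := by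
  intro ht
  apply hB
  let v : Fin (k + 2) → K := fun r => ∏ t with r.val ≤ t.val, f t
  have vlast : v (Fin.last (k + 1)) = 1 := by
    refine prod_eq_one fun t h => ?_
    simp only [mem_filter, Fin.val_last] at h
    exact absurd h.2 (by omega)
  have vsucc : ∀ t : Fin (k + 1), v t.castSucc = f t * v t.succ := by
    intro t
    have : (univ.filter fun t' : Fin (k + 1) => t.castSucc.val ≤ t'.val)
        = insert t (univ.filter fun t' : Fin (k + 1) => t.succ.val ≤ t'.val) := by
      ext t'
      simp only [mem_filter, mem_univ, true_and, mem_insert, Fin.ext_iff, Fin.val_castSucc,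
        Fin.val_succ]
      omega
    change (∏ t' with t.castSucc.val ≤ t'.val, f t') = _
    rw [this, prod_insert (by simp)]
  have v0 : v 0 = 0 := by
    change (∏ t with (0 : Fin (k + 2)).val ≤ t.val, f t) = 0
    simp only [Fin.val_zero, Nat.zero_le, filter_true]
    rw [← pre_last, pre_eq_tail, ht, mul_zero]
  have v1 : v 1 = 0 := by
    have h := vsucc 0
    rw [Fin.castSucc_zero, v0] at h
    exact (mul_eq_zero.1 h.symm).resolve_left h0
  refine Matrix.exists_mulVec_eq_zero_iff.1 ⟨fun r => RatFunc.C (v r), ?_, ?_⟩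
  · intro h
    have := congrFun h (Fin.last (k + 1))
    simp [vlast] at this
  funext r
  rw [Matrix.mulVec, dotProduct, Pi.zero_apply]
  induction r using Fin.lastCases with
  | cast t =>
    have hlt : (t.castSucc : Fin (k + 2)).val < k + 1 := t.isLt
    rw [sum_eq_add_of_mem t.castSucc t.succ (mem_univ _) (mem_univ _) Fin.castSucc_lt_succ.ne]
    · have hle : t.val ≤ k := by omega
      simp [matB, hle, vsucc]
    · intro s _ hs
      have h1 : s.val ≠ t.castSucc.val := fun h => hs.1 (Fin.ext h)
      have h2 : s.val ≠ t.castSucc.val + 1 := fun h => hs.2 (Fin.ext h)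
      rw [matB, if_pos hlt, if_neg h1, if_neg h2, zero_mul]
  | last =>
    refine sum_eq_zero fun s _ => ?_
    have hG : bigG (extend f c) a / smallG (extend f c) a = 1 := by
      rw [div_eq_one_iff_eq hg, bigG_extend, smallG_extend, ht]; ring
    rw [matB, if_neg (by simp), hG]
    by_cases hs0 : s = 0
    · simp [hs0, v0]
    by_cases hs1 : s = 1
    · simp [hs1, v1]
    have e0 : s.val ≠ 0 := fun h => hs0 (Fin.ext h)
    have e1 : s.val ≠ 1 := fun h => hs1 (Fin.ext (by simpa using h))
    simp [e0, e1]

lemma Regular.ne_zero (h : Regular (extend f c) a) (s : Fin (k + 1)) : f s ≠ 0 := by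
  have ht := tail_ne_zero_of_det_ne_zero (by simpa using h.1) h.2.1 h.2.2
  have h0 : f 0 ≠ 0 := by simpa using h.1
  have hp : ∏ t, f t ≠ 0 := by
    rw [← pre_last, pre_eq_tail]
    exact mul_ne_zero h0 ht
  exact prod_ne_zero_iff.1 hp s (mem_univ s)

/-- Identifies the last component `d` of the cyclic chain as the one that makes the product of all
components equal to `a`, independently of `c`. -/
lemma ratio_relation (hf : ∀ s, f s ≠ 0) (hg : smallG (extend f c) a ≠ 0) :
    (1 - ratio f c a * f 0) * (a / pre f (k + 1)) = c - ratio f c a := by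
  have h0 := hf 0
  have ht : tail f ≠ 0 := prod_ne_zero_iff.2 fun i _ => hf i.succ
  rw [smallG_extend] at hg
  rw [ratio, pre_eq_tail, bigG_extend, smallG_extend]
  field_simp
  ring

lemma Regular.darboux_eq (h : Regular (extend f c) a) :
    darboux (extend f c) a = cycDarboux (extend f (a / pre f (k + 1))) := by
  have hf := h.ne_zero
  have hd := ratio_relation hf h.2.1
  have hB := h.2.2
  have h1 := matB_eq_rowOp_mul f c a _ (hf 0) hd
  rw [h1, Matrix.det_mul] at hB
  rw [darboux, h1, matA_eq_rowOp_mul f c a _ hd, Matrix.mul_inv_rev, cycDarboux, mul_assoc,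
    Matrix.nonsing_inv_mul_cancel_left _ _ (left_ne_zero_of_mul hB).isUnit]

lemma regular_extend_zero (hf : ∀ s, f s ≠ 0) (ht : tail f ≠ a) : Regular (extend f 0) a := by
  have hg : smallG (extend f 0) a ≠ 0 := by
    rw [smallG_extend]; exact sub_ne_zero.2 ht
  refine ⟨by simpa using hf 0, hg, ?_⟩
  rw [matB_eq_rowOp_mul f 0 a _ (hf 0) (ratio_relation hf hg), Matrix.det_mul, det_rowOp]
  refine mul_ne_zero ((map_ne_zero _).2 ?_) (det_one_sub_ne_zero _)
  -- For `c = 0` one has `G = -a`, so `1 - G / g = tail f / (tail f - a)`.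
  rw [ratio_mul f 0 a (hf 0), bigG_extend]
  have : tail f ≠ 0 := prod_ne_zero_iff.2 fun i _ => hf i.succ
  rw [sub_ne_zero, Ne, eq_div_iff hg, smallG_extend]
  intro h
  exact this (by linear_combination h)

end Closed

/-! ### Solution of the refactorization equation -/

/-- The vector completed to a cyclic chain with the product `a` of all components. -/
noncomputable def close {m : ℕ} (f : Fin m → K) (a : K) : Fin (m + 1) → K :=
  extend f (a / pre f m)

@[simp] lemma close_castSucc {m : ℕ} (f : Fin m → K) (a : K) (s : Fin m) :
    close f a s.castSucc = f s := extend_castSucc _ _ _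

@[simp] lemma close_last {m : ℕ} (f : Fin m → K) (a : K) :
    close f a (Fin.last m) = a / pre f m := extend_last _ _

lemma prod_close {m : ℕ} {f : Fin m → K} (hf : ∀ s, f s ≠ 0) (a : K) :
    ∏ s, close f a s = a := by
  rw [Fin.prod_univ_castSucc]
  simp only [close_castSucc, close_last]
  rw [← pre_last, mul_div_cancel₀ _ (pre_ne_zero hf m)]

/-- The coefficient `κ` in `F[x] F[f] = 1 + κ (F[f] - F[g])`. -/
noncomputable def kappa {m : ℕ} (a b : K) (f g : Fin m → K) (s : Fin (m + 1)) : K :=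
  (1 - a * b) * pre f s.val * pre g s.val / P a b f g s.val

lemma kappa_swap {m : ℕ} (a b : K) (f g : Fin m → K) (s : Fin (m + 1)) :
    kappa b a g f s = -kappa a b f g s := by
  rw [kappa, kappa, P_swap a b f g, div_neg]; ring

lemma P_last {m : ℕ} (a b : K) (f g : Fin m → K) :
    P a b f g m = a * b * P a b f g 0 + (1 - a * b) * (a * pre g m - b * pre f m) := by
  rw [P_eq, P_eq]; simp; ring

lemma move_relations {m : ℕ} {a b : K} {f g : Fin m → K} (hf : ∀ s, f s ≠ 0) (hg : ∀ s, g s ≠ 0)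
    (hP : ∀ n ≤ m, P a b f g n ≠ 0) (s : Fin (m + 1)) :
    close (move a b f g) a s * kappa a b f g (s + 1) = kappa a b f g s * close f a s ∧
      1 - close (move a b f g) a s * close g b s
        = kappa a b f g s * (close f a s - close g b s) := by
  have p0 := hP 0 (Nat.zero_le m)
  have pm := hP m le_rfl
  have hF := pre_ne_zero hf m
  have hG := pre_ne_zero hg m
  induction s using Fin.lastCases with
  | cast t =>
    have p1 := hP t.val t.isLt.le
    have p2 := hP (t.val + 1) t.isLt
    have h3 := hg t
    simp only [close_castSucc, Fin.coeSucc_eq_succ, kappa, Fin.val_succ, Fin.val_castSucc, move,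
      pre_succ]
    constructor
    · field_simp
    · rw [P_succ]
      field_simp
      ring
  -- The wrap-around from `m` to `0`; in the second relation `P_last` makes the chain close up.
  | last =>
    simp only [close_last, Fin.last_add_one, kappa, Fin.val_last, Fin.val_zero, pre_zero, mul_one,
      pre_move hg hP m le_rfl]
    constructor
    · field_simp
    · field_simp
      rw [P_last]
      ring

lemma cycDarboux_move {m : ℕ} {a b : K} {f g : Fin m → K} (hf : ∀ s, f s ≠ 0)
    (hg : ∀ s, g s ≠ 0) (hP : ∀ n ≤ m, P a b f g n ≠ 0) :
    cycDarboux (close (move b a g f) b) * cycDarboux (close f a)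
      = cycDarboux (close (move a b f g) a) * cycDarboux (close g b) := by
  have hP' : ∀ n ≤ m, P b a g f n ≠ 0 := fun n hn => by
    rw [P_swap a b f g]; exact neg_ne_zero.2 (hP n hn)
  refine cycDarboux_mul_eq (κ := kappa a b f g) (fun s => ?_) (fun s => ?_)
    (fun s => (move_relations hf hg hP s).1) (fun s => (move_relations hf hg hP s).2)
  · have h := (move_relations hg hf hP' s).1
    rw [kappa_swap a b f g, kappa_swap a b f g] at h
    linear_combination -h
  · have h := (move_relations hg hf hP' s).2
    rw [kappa_swap a b f g] at h
    linear_combination h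

/-- Dividing the recursion by `κ_s κ_{s+1}` makes it linear in `1 / κ_s`. It sums to `1 / κ_0 -
theta`, and going once around the cycle fixes `κ_0`. -/
lemma eq_kappa {m : ℕ} {a b : K} {f g : Fin m → K} (hf : ∀ s, f s ≠ 0)
    (hg : ∀ s, g s ≠ 0) {h κ : Fin (m + 1) → K}
    (hh : ∀ s, h s = 1 - κ s * (close f a s - close g b s))
    (hκ : ∀ s, κ s * close f a s * close g b s = κ (s + 1) * h s)
    (hprod : ∏ s, h s = a * b) (s : Fin (m + 1)) :
    P a b f g s.val * κ s = (1 - a * b) * pre f s.val * pre g s.val := by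
  have hF := pre_ne_zero hf m
  have hG := pre_ne_zero hg m
  have step : ∀ s, κ s = 0 → κ (s + 1) = 0 := by
    intro s hs
    have h1 := hκ s
    rw [hh s, hs] at h1
    simpa using h1.symm
  -- A zero of `κ` propagates around the whole cycle. Then every `h_s` is `1`, so `a * b = 1` and
  -- both sides vanish.
  by_cases h0 : κ 0 = 0
  · have hall : ∀ s, κ s = 0 := by
      intro s
      induction s using Fin.induction with
      | zero => exact h0
      | succ t ih => rw [← Fin.coeSucc_eq_succ]; exact step _ ih
    have hab : a * b = 1 := by
      rw [← hprod]
      exact prod_eq_one fun s _ => by rw [hh, hall]; ring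
    rw [hall, hab]; ring
  · have hne : ∀ s, κ s ≠ 0 := by
      intro s
      induction s using Fin.reverseInduction with
      | last =>
        intro hs
        have := step _ hs
        rw [Fin.last_add_one] at this
        exact h0 this
      | cast t ih =>
        intro hs
        have := step _ hs
        rw [Fin.coeSucc_eq_succ] at this
        exact ih this
    have hd : ∀ s, (κ (s + 1))⁻¹ * close f a s * close g b s
        = (κ s)⁻¹ - (close f a s - close g b s) := by
      intro s
      have h1 := hκ s
      have h2 := hne s
      have h3 := hne (s + 1)
      rw [hh] at h1
      field_simp
      linear_combination h1
    have hsum : ∀ s : Fin (m + 1), (κ s)⁻¹ * pre f s.val * pre g s.val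
        = (κ 0)⁻¹ - theta f g s.val := by
      intro s
      induction s using Fin.induction with
      | zero => simp
      | succ t ih =>
        have h1 := hd t.castSucc
        rw [Fin.coeSucc_eq_succ, close_castSucc, close_castSucc] at h1
        rw [Fin.val_castSucc] at ih
        rw [Fin.val_succ, pre_succ, pre_succ, theta_succ]
        linear_combination pre f t.val * pre g t.val * h1 + ih
    have hfirst : (1 - a * b) * (κ 0)⁻¹ = a * pre g m - b * pre f m + theta f g m := by
      have h1 := hd (Fin.last m)
      have h2 := hsum (Fin.last m)
      rw [Fin.last_add_one, close_last, close_last] at h1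
      rw [Fin.val_last] at h2
      have h3 : a / pre f m * pre f m = a := div_mul_cancel₀ _ hF
      have h4 : b / pre g m * pre g m = b := div_mul_cancel₀ _ hG
      linear_combination -h2 - pre f m * pre g m * h1
        + ((κ 0)⁻¹ * (b / pre g m * pre g m) + pre g m) * h3 + ((κ 0)⁻¹ * a - pre f m) * h4
    have hs := hsum s
    have hk := hne s
    have : P a b f g s.val = (1 - a * b) * ((κ s)⁻¹ * pre f s.val * pre g s.val) := by
      rw [P_eq, hs]
      linear_combination -hfirst
    rw [this]
    field_simp

/-- Let `H_s = x_s f_s = y_s g_s` and define `κ` by `1 - H = κ (f - g)`. The `t^1` equations become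
the recursion of `eq_kappa`, and the closing conditions give `∏ H = a * b`. The resulting `κ` yields
`P_s H_s = P_{s+1}`, which is the formula for both `x` and `y`. -/
lemma eq_move_of_cycDarboux_mul_eq {m : ℕ} {a b : K} {f g x y : Fin m → K}
    (hf : ∀ s, f s ≠ 0) (hg : ∀ s, g s ≠ 0) (hx : ∀ s, x s ≠ 0)
    (hP : ∀ n ≤ m, P a b f g n ≠ 0) (hfg : ∀ s, f s ≠ g s) (hab : a * pre g m ≠ b * pre f m)
    (h : cycDarboux (close x b) * cycDarboux (close f a)
      = cycDarboux (close y a) * cycDarboux (close g b)) :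
    x = move b a g f ∧ y = move a b f g := by
  have hc := fun s => coeff_eq_of_cycDarboux_mul_eq h s
  have hF := pre_ne_zero hf m
  have hG := pre_ne_zero hg m
  have hne : ∀ s, close f a s - close g b s ≠ 0 := by
    intro s
    rw [sub_ne_zero]
    induction s using Fin.lastCases with
    | cast t => simpa using hfg t
    | last =>
      rw [close_last, close_last, Ne, div_eq_div_iff hF hG]
      exact hab
  set H : Fin (m + 1) → K := fun s => close x b s * close f a s with hH
  set κ : Fin (m + 1) → K := fun s => (1 - H s) / (close f a s - close g b s) with hκ
  have hh : ∀ s, H s = 1 - κ s * (close f a s - close g b s) := by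
    intro s
    rw [hκ]
    simp only
    rw [div_mul_cancel₀ _ (hne s)]
    ring
  clear_value κ
  have hrec : ∀ s, κ s * close f a s * close g b s = κ (s + 1) * H s := by
    intro s
    obtain ⟨h1, h2⟩ := hc s
    have h1' := (hc (s + 1)).1
    have h3 := hh s
    have h4 := hh (s + 1)
    -- The `t^1` equation with `1 - H` replaced by `κ (f - g)` at `s` and `s + 1`; the common factor
    -- at `s + 1` cancels.
    have h5 : κ s * (close f a s - close g b s)
        = -(κ (s + 1) * (close x b s - close y a s)) := by
      apply mul_right_cancel₀ (hne (s + 1))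
      simp only [hH] at h3 h4
      linear_combination h2 + (close f a (s + 1) - close g b (s + 1)) * h3
        + (close x b s - close y a s) * h4 + close g b (s + 1) * h1 + close y a s * h1'
    apply mul_right_cancel₀ (hne s)
    simp only [hH]
    linear_combination close f a s * close g b s * h5 - κ (s + 1) * close f a s * h1
  have hprod : ∏ s, H s = a * b := by
    rw [hH, prod_mul_distrib, prod_close hx, prod_close hf, mul_comm]
  have hk := eq_kappa hf hg hh hrec hprod
  have hval : ∀ s : Fin m, P a b f g s.val * H s.castSucc = P a b f g (s.val + 1) := by
    intro s
    have h1 := hk s.castSucc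
    rw [Fin.val_castSucc] at h1
    rw [hh, P_succ, close_castSucc, close_castSucc]
    linear_combination -(f s - g s) * h1
  constructor
  · funext s
    have h1 := hval s
    have p := hP s.val s.isLt.le
    have h2 := hf s
    simp only [hH, close_castSucc] at h1
    rw [move, P_swap a b f g, P_swap a b f g, eq_div_iff (by simp [p, h2])]
    linear_combination -h1
  · funext s
    have h1 := hval s
    have h3 := (hc s.castSucc).1
    have p := hP s.val s.isLt.le
    have h2 := hg s
    simp only [hH] at h1
    rw [h3, close_castSucc, close_castSucc] at h1
    rw [move, eq_div_iff (mul_ne_zero h2 p)]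
    linear_combination h1

/-! ### Genericity of the nonvanishing conditions -/

section Generic

variable {ι : Type*} {m : ℕ}

/-- The function is given by a polynomial in the variables `f^{(i)}_s`. -/
def IsPoly (φ : (ι → Fin m → K) → K) : Prop :=
  ∃ D : MvPolynomial (ι × Fin m) K, ∀ f, MvPolynomial.eval (fun p => f p.1 p.2) D = φ f

namespace IsPoly

lemma const (c : K) : IsPoly fun _ : ι → Fin m → K => c := ⟨MvPolynomial.C c, fun f => by simp⟩

lemma coord (i : ι) (s : Fin m) : IsPoly fun f : ι → Fin m → K => f i s :=
  ⟨MvPolynomial.X (i, s), fun f => by simp⟩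

variable {φ ψ : (ι → Fin m → K) → K}

lemma add (hφ : IsPoly φ) (hψ : IsPoly ψ) : IsPoly fun f => φ f + ψ f := by
  obtain ⟨D, hD⟩ := hφ
  obtain ⟨E, hE⟩ := hψ
  exact ⟨D + E, fun f => by rw [map_add, hD, hE]⟩

lemma mul (hφ : IsPoly φ) (hψ : IsPoly ψ) : IsPoly fun f => φ f * ψ f := by
  obtain ⟨D, hD⟩ := hφ
  obtain ⟨E, hE⟩ := hψ
  exact ⟨D * E, fun f => by rw [map_mul, hD, hE]⟩

lemma sub (hφ : IsPoly φ) (hψ : IsPoly ψ) : IsPoly fun f => φ f - ψ f := by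
  obtain ⟨D, hD⟩ := hφ
  obtain ⟨E, hE⟩ := hψ
  exact ⟨D - E, fun f => by rw [map_sub, hD, hE]⟩

lemma sum {κ : Type*} {s : Finset κ} {Φ : κ → (ι → Fin m → K) → K}
    (h : ∀ t ∈ s, IsPoly (Φ t)) : IsPoly fun f => ∑ t ∈ s, Φ t f := by
  classical
  induction s using Finset.induction_on with
  | empty => simpa using const 0
  | insert t s ht ih =>
    simp only [sum_insert ht]
    exact (h t (mem_insert_self t s)).add (ih fun t' h' => h t' (mem_insert_of_mem h'))

lemma prod {κ : Type*} {s : Finset κ} {Φ : κ → (ι → Fin m → K) → K}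
    (h : ∀ t ∈ s, IsPoly (Φ t)) : IsPoly fun f => ∏ t ∈ s, Φ t f := by
  classical
  induction s using Finset.induction_on with
  | empty => simpa using const 1
  | insert t s ht ih =>
    simp only [prod_insert ht]
    exact (h t (mem_insert_self t s)).mul (ih fun t' h' => h t' (mem_insert_of_mem h'))

lemma pre (i : ι) (n : ℕ) : IsPoly fun f : ι → Fin m → K => DSK.pre (f i) n :=
  prod fun t _ => coord i t

lemma theta (i j : ι) (n : ℕ) : IsPoly fun f : ι → Fin m → K => DSK.theta (f i) (f j) n :=
  sum fun t _ => (((coord i t).sub (coord j t)).mul (pre i _)).mul (pre j _)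

lemma P (a b : K) (i j : ι) (n : ℕ) : IsPoly fun f : ι → Fin m → K => DSK.P a b (f i) (f j) n := by
  simp only [P_eq]
  exact ((((const a).mul (pre j m)).sub ((const b).mul (pre i m))).add (theta i j m)).add
    ((const _).mul (theta i j n))

lemma cubeP (a b c : K) (i j k : ι) (n : ℕ) :
    IsPoly fun f : ι → Fin m → K => DSK.cubeP a b c (f i) (f j) (f k) n := by
  simp only [DSK.cubeP]
  exact ((const _).mul ((((const _).mul (P b c j k n)).mul (pre i n)).sub
    (((const _).mul (P a c i k n)).mul (pre j n)))).add
    (((const _).mul (P a b i j n)).mul (pre k n))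

lemma generic_ne_zero (hφ : IsPoly φ) (h : ∃ f, φ f ≠ 0) : Generic fun f => φ f ≠ 0 := by
  obtain ⟨D, hD⟩ := hφ
  obtain ⟨f, hf⟩ := h
  refine ⟨D, ?_, fun f h => by rwa [hD] at h⟩
  rintro rfl
  exact hf (by rw [← hD, map_zero])

end IsPoly

lemma Generic.mono {S T : (ι → Fin m → K) → Prop} (hS : Generic S) (h : ∀ f, S f → T f) :
    Generic T := by
  obtain ⟨D, h0, hD⟩ := hS
  exact ⟨D, h0, fun f hf => h f (hD f hf)⟩

lemma Generic.and {S T : (ι → Fin m → K) → Prop} (hS : Generic S) (hT : Generic T) :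
    Generic fun f => S f ∧ T f := by
  obtain ⟨D, h0, hD⟩ := hS
  obtain ⟨E, h1, hE⟩ := hT
  refine ⟨D * E, mul_ne_zero h0 h1, fun f hf => ?_⟩
  rw [map_mul] at hf
  exact ⟨hD f (left_ne_zero_of_mul hf), hE f (right_ne_zero_of_mul hf)⟩

lemma generic_forall {κ : Type*} [Fintype κ] {S : κ → (ι → Fin m → K) → Prop}
    (hS : ∀ t, Generic (S t)) : Generic fun f => ∀ t, S t f := by
  choose D h0 hD using hS
  refine ⟨∏ t, D t, prod_ne_zero_iff.2 fun t _ => h0 t, fun f hf t => hD t f ?_⟩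
  rw [map_prod] at hf
  exact prod_ne_zero_iff.1 hf t (mem_univ t)

lemma generic_coord_ne_zero (i : ι) : Generic fun f : ι → Fin m → K => ∀ s, f i s ≠ 0 :=
  generic_forall fun s => (IsPoly.coord i s).generic_ne_zero ⟨fun _ _ => 1, one_ne_zero⟩

lemma generic_coord_ne {i j : ι} (h : i ≠ j) :
    Generic fun f : ι → Fin m → K => ∀ s, f i s ≠ f j s := by
  classical
  refine generic_forall fun s => (((IsPoly.coord i s).sub (IsPoly.coord j s)).generic_ne_zero
    ⟨fun l _ => if l = i then 1 else 0, ?_⟩).mono fun f hf => sub_ne_zero.1 hf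
  simp [h.symm]

/-- On equal arguments every `theta` vanishes; this makes equal constant vectors convenient
witnesses. -/
lemma P_self (a b : K) (f : Fin m → K) (n : ℕ) : P a b f f n = (a - b) * pre f m := by
  rw [P_eq]; simp [theta]; ring

lemma generic_P_ne_zero {a b : K} (h : a ≠ b) (i j : ι) :
    Generic fun f : ι → Fin m → K => ∀ n ≤ m, P a b (f i) (f j) n ≠ 0 := by
  refine (generic_forall (κ := Fin (m + 1)) fun n =>
    (IsPoly.P a b i j n.val).generic_ne_zero ⟨fun _ _ => 1, ?_⟩).mono
      fun f hf n hn => hf ⟨n, Nat.lt_succ_of_le hn⟩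
  rw [P_self]
  simp [pre, sub_ne_zero.2 h]

lemma generic_cubeP_ne_zero {a b c : K} (hab : a ≠ b) (hac : a ≠ c) (hbc : b ≠ c) (i j k : ι) :
    Generic fun f : ι → Fin m → K => ∀ n ≤ m, cubeP a b c (f i) (f j) (f k) n ≠ 0 := by
  refine (generic_forall (κ := Fin (m + 1)) fun n =>
    (IsPoly.cubeP a b c i j k n.val).generic_ne_zero ⟨fun _ _ => 1, ?_⟩).mono
      fun f hf n hn => hf ⟨n, Nat.lt_succ_of_le hn⟩
  -- At the all-ones point `cubeP` is a Vandermonde product.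
  have h : cubeP a b c (fun _ : Fin m => 1) (fun _ => 1) (fun _ => 1) n.val
      = (a - b) * (b - c) * (a - c) := by
    rw [cubeP, P_self, P_self, P_self]
    simp [pre]
    ring
  rw [h]
  exact mul_ne_zero (mul_ne_zero (sub_ne_zero.2 hab) (sub_ne_zero.2 hbc)) (sub_ne_zero.2 hac)

lemma generic_prod_ne {a b : K} (h : a ≠ b) (i j : ι) :
    Generic fun f : ι → Fin m → K => a * pre (f j) m ≠ b * pre (f i) m := by
  refine ((((IsPoly.const a).mul (IsPoly.pre j m)).sub
    ((IsPoly.const b).mul (IsPoly.pre i m))).generic_ne_zero ⟨fun _ _ => 1, ?_⟩).mono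
      fun f hf => sub_ne_zero.1 hf
  simp [pre, sub_ne_zero.2 h]

end Generic

section Tail

variable {ι : Type*} {k : ℕ}

lemma IsPoly.tail (i : ι) : IsPoly fun f : ι → Fin (k + 1) → K => DSK.tail (f i) :=
  prod fun _ _ => coord i _

/-- Supplies constant vectors as witnesses for the `tail` conditions. Only `a = 1` needs `t = 2`,
where characteristic zero enters; for `k = 0` the powers are `1`, whence the exception at `m = 1`.
-/
lemma exists_pow_ne [CharZero K] {a : K} (h : k = 0 → a ≠ 1) :
    ∃ t : K, t ≠ 0 ∧ t ^ k ≠ a ∧ a * t ^ k ≠ 1 := by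
  by_cases ha : a = 1
  · have hk : k ≠ 0 := fun hk => h hk ha
    have h2 : (2 : K) ^ k ≠ 1 := by
      intro h2
      have : 2 ^ k = 1 := by exact_mod_cast h2
      exact hk (by simpa using this)
    exact ⟨2, two_ne_zero, by rwa [ha], by rwa [ha, one_mul]⟩
  · exact ⟨1, one_ne_zero, by simpa using Ne.symm ha, by simpa using ha⟩

lemma generic_tail_ne [CharZero K] {a : K} (h : k = 0 → a ≠ 1) (i : ι) :
    Generic fun f : ι → Fin (k + 1) → K => tail (f i) ≠ a := by
  obtain ⟨t, -, ht, -⟩ := exists_pow_ne h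
  refine (((IsPoly.tail i).sub (IsPoly.const a)).generic_ne_zero ⟨fun _ _ => t, ?_⟩).mono
    fun f hf => sub_ne_zero.1 hf
  simpa [tail, sub_eq_zero] using ht

lemma tail_move {a b : K} {f g : Fin (k + 1) → K} (hg : ∀ s, g s ≠ 0)
    (hP : ∀ n ≤ k + 1, P a b f g n ≠ 0) :
    tail (move a b f g) * (tail g * P a b f g 1) = P a b f g (k + 1) := by
  have h := pre_move hg hP (k + 1) le_rfl
  have p0 := hP 0 (by omega)
  have p1 := hP 1 (by omega)
  have h0 := hg 0
  have ht : tail g ≠ 0 := prod_ne_zero_iff.2 fun i _ => hg i.succ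
  rw [pre_eq_tail, pre_eq_tail, move] at h
  simp only [Fin.val_zero, zero_add] at h
  field_simp at h
  linear_combination h

/-- Needed for `F` to make sense at the shifted vector. At a constant vector `t` all `P_n` coincide,
so by `tail_move` the condition reads `a t^k ≠ 1`. -/
lemma generic_tail_move_ne [CharZero K] {a b : K} (hab : a ≠ b) (h : k = 0 → a ≠ 1) (i j : ι) :
    Generic fun f : ι → Fin (k + 1) → K => tail (move a b (f i) (f j)) ≠ a := by
  obtain ⟨t, h0, -, ht⟩ := exists_pow_ne h
  refine ((generic_coord_ne_zero j).and ((generic_P_ne_zero hab i j).and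
    (((IsPoly.P a b i j (k + 1)).sub ((IsPoly.const a).mul
      ((IsPoly.tail j).mul (IsPoly.P a b i j 1)))).generic_ne_zero
        ⟨fun _ _ => t, ?_⟩))).mono ?_
  · rw [P_self, P_self]
    have : (a - b) * pre (fun _ : Fin (k + 1) => t) (k + 1) - a * (tail (fun _ : Fin (k + 1) => t)
        * ((a - b) * pre (fun _ : Fin (k + 1) => t) (k + 1)))
        = (a - b) * t ^ (k + 1) * (1 - a * t ^ k) := by
      simp [pre_last, tail]
      ring
    rw [this]
    exact mul_ne_zero (mul_ne_zero (sub_ne_zero.2 hab) (pow_ne_zero _ h0))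
      (sub_ne_zero.2 (Ne.symm ht))
  · rintro f ⟨hg, hP, hne⟩ hm
    apply hne
    rw [← tail_move hg hP, hm]
    ring

end Tail

/-! ### Assembly of the two statements -/

lemma move_ne_zero {m : ℕ} {a b : K} {f g : Fin m → K} (hg : ∀ s, g s ≠ 0)
    (hP : ∀ n ≤ m, P a b f g n ≠ 0) (s : Fin m) : move a b f g s ≠ 0 :=
  div_ne_zero (hP _ s.isLt) (mul_ne_zero (hg s) (hP _ s.isLt.le))

lemma uniquelyRefactorizes {ι : Type*} {k : ℕ} {α : ι → K} {i j : ι}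
    {f : ι → Fin (k + 1) → K} (hi : ∀ s, f i s ≠ 0) (hj : ∀ s, f j s ≠ 0)
    (hP : ∀ n ≤ k + 1, P (α i) (α j) (f i) (f j) n ≠ 0) (hne : ∀ s, f i s ≠ f j s)
    (hprod : α i * pre (f j) (k + 1) ≠ α j * pre (f i) (k + 1))
    (hti : tail (f i) ≠ α i) (htj : tail (f j) ≠ α j)
    (hmi : tail (move (α i) (α j) (f i) (f j)) ≠ α i)
    (hmj : tail (move (α j) (α i) (f j) (f i)) ≠ α j) : UniquelyRefactorizes α i j f := by
  have hP' : ∀ n ≤ k + 1, P (α j) (α i) (f j) (f i) n ≠ 0 := fun n hn => by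
    rw [P_swap (α i) (α j)]; exact neg_ne_zero.2 (hP n hn)
  refine ⟨⟨0, regular_extend_zero hi hti⟩, ⟨0, regular_extend_zero hj htj⟩,
    fun s => mul_ne_zero (hi s) (hP' _ s.isLt.le), fun s => mul_ne_zero (hj s) (hP _ s.isLt.le),
    ⟨0, regular_extend_zero (move_ne_zero hi hP') hmj⟩,
    ⟨0, regular_extend_zero (move_ne_zero hj hP) hmi⟩, ?_⟩
  intro fm gm hrf hrg x y xm ym hrx hry
  rw [hrf.darboux_eq, hrg.darboux_eq, hrx.darboux_eq, hry.darboux_eq]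
  constructor
  · exact eq_move_of_cycDarboux_mul_eq hi hj hrx.ne_zero hP hne hprod
  · rintro ⟨rfl, rfl⟩
    exact cycDarboux_move hi hj hP

lemma cubeConsistent {ι : Type*} {m : ℕ} {α : ι → K} {i j k : ι} {f : ι → Fin m → K}
    (hj : ∀ s, f j s ≠ 0) (hk : ∀ s, f k s ≠ 0)
    (hij : ∀ n ≤ m, P (α i) (α j) (f i) (f j) n ≠ 0)
    (hik : ∀ n ≤ m, P (α i) (α k) (f i) (f k) n ≠ 0)
    (hjk : ∀ n ≤ m, P (α j) (α k) (f j) (f k) n ≠ 0)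
    (hW : ∀ n ≤ m, cubeP (α i) (α j) (α k) (f i) (f j) (f k) n ≠ 0) :
    CubeConsistent α i j k f := by
  have hkj : ∀ n ≤ m, P (α k) (α j) (f k) (f j) n ≠ 0 := fun n hn => by
    rw [P_swap (α j) (α k)]; exact neg_ne_zero.2 (hjk n hn)
  refine ⟨fun s => mul_ne_zero (hk s) (hik _ s.isLt.le),
    fun s => mul_ne_zero (hk s) (hjk _ s.isLt.le),
    fun s => mul_ne_zero (move_ne_zero hk hjk s) ?_,
    fun s => mul_ne_zero (hj s) (hij _ s.isLt.le),
    fun s => mul_ne_zero (hj s) (hkj _ s.isLt.le),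
    fun s => mul_ne_zero (move_ne_zero hj hkj s) ?_,
    fun s => congrFun (move_move hj hk hik hjk hij) s⟩
  -- By `P_move` the denominators of a double shift are `cubeP` up to factors.
  · intro h0
    apply hW _ s.isLt.le
    rw [← P_move hk hik hjk _ s.isLt.le]
    exact mul_eq_zero_of_left (mul_eq_zero_of_left h0 _) _
  · intro h0
    apply neg_ne_zero.2 (hW _ s.isLt.le)
    rw [← cubeP_swap, ← P_move hj hij hkj _ s.isLt.le]
    exact mul_eq_zero_of_left (mul_eq_zero_of_left h0 _) _

end DSK

theorem mainTheorem4 {K : Type*} [Field K] [CharZero K] (m : ℕ) (hm : 1 ≤ m)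
    {ι : Type*} (α : ι → K) :
    (∀ i j : ι, α i ≠ α j → (m = 1 → α i ≠ 1 ∧ α j ≠ 1) →
      DSK.Generic (fun f : ι → Fin m → K => DSK.UniquelyRefactorizes α i j f)) ∧
    (∀ i j k : ι, α i ≠ α j → α i ≠ α k → α j ≠ α k →
      DSK.Generic (fun f : ι → Fin m → K => DSK.CubeConsistent α i j k f)) := by
  obtain ⟨n, rfl⟩ : ∃ n, m = n + 1 := ⟨m - 1, by omega⟩
  constructor
  · intro i j hij h1
    have hi : n = 0 → α i ≠ 1 := fun hn => (h1 (by omega)).1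
    have hj : n = 0 → α j ≠ 1 := fun hn => (h1 (by omega)).2
    have hne : i ≠ j := fun h => hij (congrArg α h)
    refine ((DSK.generic_coord_ne_zero i).and <| (DSK.generic_coord_ne_zero j).and <|
      (DSK.generic_P_ne_zero hij i j).and <| (DSK.generic_coord_ne hne).and <|
      (DSK.generic_prod_ne hij i j).and <| (DSK.generic_tail_ne hi i).and <|
      (DSK.generic_tail_ne hj j).and <| (DSK.generic_tail_move_ne hij hi i j).and
      (DSK.generic_tail_move_ne hij.symm hj j i)).mono ?_
    rintro f ⟨h2, h3, h4, h5, h6, h7, h8, h9, h10⟩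
    exact DSK.uniquelyRefactorizes h2 h3 h4 h5 h6 h7 h8 h9 h10
  · intro i j k hij hik hjk
    refine ((DSK.generic_coord_ne_zero j).and <| (DSK.generic_coord_ne_zero k).and <|
      (DSK.generic_P_ne_zero hij i j).and <| (DSK.generic_P_ne_zero hik i k).and <|
      (DSK.generic_P_ne_zero hjk j k).and
      (DSK.generic_cubeP_ne_zero hij hik hjk i j k)).mono ?_
    rintro f ⟨h2, h3, h4, h5, h6, h7⟩
    exact DSK.cubeConsistent h2 h3 h4 h5 h6 h7
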